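/- Fix real parameters $a,b,d_2,\alpha$. For $\omega>0$ with $\beta:=-\tfrac{16}{3}\alpha\omega<1$ let $$R_0^2(z)=\frac{4\omega}{1+\sqrt{1-\beta}\,\cosh(2\sqrt\omega\,z)},\qquad R_0>0,\qquad S_0=R_0'/R_0,$$ so that $(r,s,\phi)=(R_0,S_0,0)$ solves, at $c=\varepsilon=0$, the steady-state system with parameters $(\omega,c,\varepsilon)$ and $\Delta=1+\varepsilon^2a^2$, $$\begin{aligned} r'&=rs,\\ \Delta s'&=-\Delta s^2+\Delta\phi^2-c(\varepsilon as-\phi)-(-\omega+\varepsilon^2ab)-(1+\varepsilon^2ad_1)r^2-(\alpha+\varepsilon^2ad_2)r^4,\\ \Delta\phi'&=-2\Delta s\phi-c(s+\varepsilon a\phi)-\varepsilon\big[(b+a\omega)+(d_1-a)r^2+(d_2-a\alpha)r^4\big].\end{aligned}$$ Let $\phi_\varepsilon(z)=\phi_\varepsilon(z;d_1,\omega)$ be the $\delta\phi$-component of the derivative at $\varepsilon=0$, $c=0$ of the unstable manifold of the rest point with $r=0$, $s>0$; that is, the $\delta\phi$-component of a solution $(\delta r,\delta s,\delta\phi)$,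 bounded as $z\to-\infty$, of the variational equation of this system along $(R_0,S_0,0)$ at $c=\varepsilon=0$ with $\delta\omega=\delta c=0$, $\delta\varepsilon=1$. Put $$\Lambda_m=\int_{-\infty}^{\infty}R_0^m(z)\,dz,\qquad \Lambda_{24}=\frac{\Lambda_2}{\Lambda_4},\qquad \Lambda_{d_2}=-\frac{8\omega}{\beta}\Big(\omega\Lambda_{24}-\frac34\Big)$$ (if $\alpha=0$, $\Lambda_{d_2}$ means its limiting value $\Lambda_6/\Lambda_4$), regarded as functions of $\omega$ with $\alpha$ fixed, and $$d_1^*(\omega)=\tfrac14a-\Lambda_{24}\,b-\Lambda_{d_2}\big(d_2-\tfrac13\alpha a\big).$$ Then for every real $d_1$ and every $\omega>0$ with $\beta<1$: 1. $\phi_\varepsilon$ exists and is unique. Moreover, let $W(\varepsilon,z)$, $|\varepsilon|<\varepsilon_0$, $z<T$, be any $C^1$ family such that each $W(\varepsilon,\cdot)$ solves the steady-state system with $c=0$ and converges as $z\to-\infty$ to a rest point with $r=0$, $s>0$, such that $W(0,\cdot)=(R_0,S_0,0)$, and such that $\partial_\varepsilon W(0,z)$ is bounded as $z\to-\infty$.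 Then the $\varepsilon$-derivative at $\varepsilon=0$ of the $\phi$-component of $W(\varepsilon,z)$ is $\phi_\varepsilon(z)$ for all $z<T$. 2. $\Lambda_{24}$ and $\Lambda_{d_2}$ are differentiable in $\omega$, and $\phi_\varepsilon(0;d_1,\omega)$, with $d_1$ held fixed, is differentiable in $\omega$ at any $\omega$ for which $d_1=d_1^*(\omega)$. There $$\partial_\omega\phi_\varepsilon(0)=-\frac{\Lambda_4}{2R_0^2(0)}\Big(\partial_\omega\Lambda_{24}\,b+\partial_\omega\Lambda_{d_2}\big(d_2-\tfrac13\alpha a\big)\Big).$$ -/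

import Mathlib

open Filter Topology MeasureTheory Set

noncomputable section

namespace PulseCQNLS

/-- The parameter `β = -16 α ω / 3`. -/
def beta (α ω : ℝ) : ℝ := -(16 / 3) * α * ω

/-- The square `R₀²(z)` of the unperturbed pulse. -/
def pulseSq (α ω z : ℝ) : ℝ :=
  4 * ω / (1 + Real.sqrt (1 - beta α ω) * Real.cosh (2 * Real.sqrt ω * z))

/-- The unperturbed pulse `R₀(z)`. -/
def pulseR (α ω z : ℝ) : ℝ := Real.sqrt (pulseSq α ω z)

/-- `S₀ = R₀' / R₀`. -/
def pulseS (α ω z : ℝ) : ℝ := deriv (pulseR α ω) z / pulseR α ω z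

/-- The unperturbed wave `(r, s, φ) = (R₀, S₀, 0)`. -/
def pulse (α ω z : ℝ) : ℝ × ℝ × ℝ := (pulseR α ω z, pulseS α ω z, 0)

/-- `Δ = 1 + ε² a²`. -/
def bigDelta (a ε : ℝ) : ℝ := 1 + ε ^ 2 * a ^ 2

/-- Right-hand side of the steady-state system for `(r, s, φ)` with the parameters `(ω, c, ε)`
adjoined: `r' = r s`, and the equations for `Δ s'` and `Δ φ'` divided by `Δ > 0`. -/
def steadyField (a b d₁ d₂ α : ℝ) : (ℝ × ℝ × ℝ) × (ℝ × ℝ × ℝ) → ℝ × ℝ × ℝ :=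
  fun ((r, s, φ), (ω, c, ε)) =>
    (r * s,
     (-bigDelta a ε * s ^ 2 + bigDelta a ε * φ ^ 2 - c * (ε * a * s - φ)
        - (-ω + ε ^ 2 * a * b) - (1 + ε ^ 2 * a * d₁) * r ^ 2
        - (α + ε ^ 2 * a * d₂) * r ^ 4) / bigDelta a ε,
     (-2 * bigDelta a ε * s * φ - c * (s + ε * a * φ)
        - ε * ((b + a * ω) + (d₁ - a) * r ^ 2 + (d₂ - a * α) * r ^ 4)) / bigDelta a ε)

/-- `ξ = (δr, δs, δφ)` is a tangent vector field to the unstable manifold, along the unperturbed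
wave, in the direction of `ε`: it solves the variational equation of the steady-state system along
`(R₀, S₀, 0)` at `c = ε = 0`, with `δω = δc = 0` and `δε = 1`, and it stays bounded as
`z → -∞`. -/
def IsEpsTangent (a b d₁ d₂ α ω : ℝ) (ξ : ℝ → ℝ × ℝ × ℝ) : Prop :=
  (∀ z : ℝ, HasDerivAt ξ
    (fderiv ℝ (steadyField a b d₁ d₂ α) (pulse α ω z, (ω, 0, 0)) (ξ z, (0, 0, 1))) z) ∧
  ∃ M : ℝ, ∀ᶠ z in atBot, ‖ξ z‖ ≤ M

/-- `φ` is the `δφ`-component of such a tangent field. (The components `δr`, `δs` are determined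
only up to a shift of phase, `δφ` is unique.) -/
def IsPhiEps (a b d₁ d₂ α ω : ℝ) (φ : ℝ → ℝ) : Prop :=
  ∃ ξ : ℝ → ℝ × ℝ × ℝ, IsEpsTangent a b d₁ d₂ α ω ξ ∧ ∀ z, φ z = (ξ z).2.2

/-- The function `φ_ε(z)`. -/
def phiEps (a b d₁ d₂ α ω : ℝ) : ℝ → ℝ :=
  Classical.epsilon (IsPhiEps a b d₁ d₂ α ω)

/-- `W ε z`, for `|ε| < ε₀` and `z < T`, is a `C¹` parametrization (with wave speed `c = 0`) of the
trajectories `z ↦ W ε z` of the steady-state system that lie on the unstable manifold of the rest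
point with `r = 0` and `s > 0`, reducing to the pulse at `ε = 0`, and with `∂_ε W` bounded as
`z → -∞` at `ε = 0`. -/
structure IsUnstableFamily (a b d₁ d₂ α ω ε₀ T : ℝ) (W : ℝ → ℝ → ℝ × ℝ × ℝ) : Prop where
  solves : ∀ ε, |ε| < ε₀ → ∀ z < T,
    HasDerivAt (W ε) (steadyField a b d₁ d₂ α (W ε z, (ω, 0, ε))) z
  tendsto_rest : ∀ ε, |ε| < ε₀ → ∃ q : ℝ × ℝ × ℝ, q.1 = 0 ∧ 0 < q.2.1 ∧
    steadyField a b d₁ d₂ α (q, (ω, 0, ε)) = 0 ∧ Tendsto (W ε) atBot (𝓝 q)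
  wave : ∀ z < T, W 0 z = pulse α ω z
  smooth : ContDiffOn ℝ 1 (Function.uncurry W) (Ioo (-ε₀) ε₀ ×ˢ Iio T)
  bounded : ∃ M : ℝ, ∀ᶠ z in atBot, ‖deriv (fun ε => W ε z) 0‖ ≤ M

/-- `Λ_m = ∫ R₀^m`. -/
def Lam (m : ℕ) (α ω : ℝ) : ℝ := ∫ z : ℝ, pulseR α ω z ^ m

/-- `Λ₂₄ = Λ₂ / Λ₄`. -/
def lam24 (α ω : ℝ) : ℝ := Lam 2 α ω / Lam 4 α ω

/-- `Λ_{d₂} = -(8ω/β)(ω Λ₂₄ - 3/4)`; at `α = 0` (that is, `β = 0`), where this expression is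
meaningless, its limiting value `Λ₆ / Λ₄` is meant. -/
def lamD2 (α ω : ℝ) : ℝ :=
  open Classical in
  if α = 0 then Lam 6 α ω / Lam 4 α ω
  else -(8 * ω / beta α ω) * (ω * lam24 α ω - 3 / 4)

/-- The (leading-order) value `d₁*` for which the wave exists. -/
def dOneStar (a b d₂ α ω : ℝ) : ℝ :=
  1 / 4 * a - lam24 α ω * b - lamD2 α ω * (d₂ - 1 / 3 * α * a)

end PulseCQNLS

end

namespace PulseCQNLS

/-! Along the pulse the linearised equation for `δφ` decouples from `δr` and `δs`, and `R₀²` is an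
integrating factor: `(R₀² δφ)' = -F(R₀²)`, with `F` the cubic `forcing`. Since `R₀²` decays at `-∞`,
boundedness kills the constant of integration, so `δφ(z) = -R₀(z)⁻² ∫_{-∞}^z F(R₀²)`. This is
`phiSol`; existence and uniqueness follow (`isPhiEps_phiSol`, `IsPhiEps.eq_phiSol`).

For families, the exact law `(r²φ)' = -(ε/Δ) F(r²)` at `c = 0` exhibits the factor `ε` before any
differentiation, so the same formula comes out at `ε = 0` (`IsUnstableFamily.hasDerivAt_phi`).

At `z = 0`, evenness turns the integral into half of the full one, a combination of `Λ₂, Λ₄, Λ₆`.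
The virial identity `Lam_relation` reduces it to `φ_ε(0) = -(Λ₄ / 2R₀²(0)) (d₁ - d₁*(ω))`
(`phiSol_zero`). Where `d₁ = d₁*(ω)`, the derivative of the prefactor is multiplied by zero, leaving
the stated formula. -/

/-! ### Decay, moments and virial identity of the normalised profile. -/

/-- The normalised squared profile `1 / (1 + p cosh y)`. -/
noncomputable def profile (p y : ℝ) : ℝ := (1 + p * Real.cosh y)⁻¹

/-- The moments of the normalised profile. -/
noncomputable def profileMoment (k : ℕ) (p : ℝ) : ℝ := ∫ y : ℝ, profile p y ^ k

lemma profile_denom_pos {p : ℝ} (hp : 0 < p) (y : ℝ) : 0 < 1 + p * Real.cosh y := by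
  have := mul_pos hp (Real.cosh_pos y)
  linarith

lemma profile_pos {p : ℝ} (hp : 0 < p) (y : ℝ) : 0 < profile p y :=
  inv_pos.2 (profile_denom_pos hp y)

lemma profile_le_one {p : ℝ} (hp : 0 < p) (y : ℝ) : profile p y ≤ 1 := by
  refine inv_le_one_of_one_le₀ ?_
  have := mul_pos hp (Real.cosh_pos y)
  linarith

lemma mul_cosh_mul_profile_le_one {p : ℝ} (hp : 0 < p) (y : ℝ) :
    p * Real.cosh y * profile p y ≤ 1 := by
  rw [profile, ← div_eq_mul_inv, div_le_one (profile_denom_pos hp y)]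
  linarith

lemma profile_antitone {p p' : ℝ} (hp : 0 < p) (h : p ≤ p') (y : ℝ) :
    profile p' y ≤ profile p y := by
  unfold profile
  have := profile_denom_pos hp y
  have := Real.cosh_pos y
  gcongr

lemma profile_neg (p y : ℝ) : profile p (-y) = profile p y := by
  simp [profile, Real.cosh_neg]

lemma profile_le_exp {p : ℝ} (hp : 0 < p) (y : ℝ) : profile p y ≤ 2 / p * Real.exp y := by
  have h1 : Real.exp (-y) ≤ 2 * Real.cosh y := by
    rw [Real.cosh_eq]
    have := Real.exp_pos y
    linarith
  have h2 : 1 ≤ 2 * Real.cosh y * Real.exp y := by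
    have := mul_le_mul_of_nonneg_right h1 (Real.exp_pos y).le
    rwa [← Real.exp_add, neg_add_cancel, Real.exp_zero] at this
  rw [profile, inv_le_iff_one_le_mul₀ (profile_denom_pos hp y)]
  have h3 : 2 / p * Real.exp y * (1 + p * Real.cosh y)
      = 2 / p * Real.exp y + 2 * Real.cosh y * Real.exp y := by
    field_simp
  rw [h3]
  have : 0 < 2 / p * Real.exp y := by positivity
  linarith

lemma exp_le_profile {p : ℝ} (hp : 0 < p) {y : ℝ} (hy : y ≤ 0) :
    (1 + p)⁻¹ * Real.exp y ≤ profile p y := by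
  have h1 : Real.cosh y ≤ Real.exp (-y) := by
    rw [Real.cosh_eq]
    have : Real.exp y ≤ Real.exp (-y) := Real.exp_le_exp.2 (by linarith)
    linarith
  have h2 : 1 ≤ Real.exp (-y) := Real.one_le_exp (by linarith)
  have h3 : (1 + p)⁻¹ * Real.exp y = ((1 + p) * Real.exp (-y))⁻¹ := by
    rw [mul_inv, Real.exp_neg, inv_inv]
  rw [h3, profile]
  refine inv_anti₀ (profile_denom_pos hp y) ?_
  nlinarith

@[fun_prop]
lemma continuous_profile {p : ℝ} (hp : 0 < p) : Continuous (profile p) := by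
  unfold profile
  exact Continuous.inv₀ (by fun_prop) fun y => (profile_denom_pos hp y).ne'

lemma integrable_profile {p : ℝ} (hp : 0 < p) : Integrable (profile p) := by
  have h1 : IntegrableOn (profile p) (Iic 0) := by
    refine Integrable.mono' (g := fun y => 2 / p * Real.exp (1 * y))
      ((integrableOn_exp_mul_Iic one_pos 0).const_mul _)
      (continuous_profile hp).aestronglyMeasurable (ae_of_all _ fun y => ?_)
    rw [Real.norm_of_nonneg (profile_pos hp y).le, one_mul]
    exact profile_le_exp hp y
  have h2 : IntegrableOn (profile p) (Ici 0) := by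
    have := IntegrableOn.comp_neg_Ici (c := 0) (f := profile p) (by simpa using h1)
    simpa [profile_neg] using this
  rw [← integrableOn_univ, ← Iic_union_Ici (a := (0 : ℝ))]
  exact h1.union h2

lemma integrable_profile_pow {p : ℝ} (hp : 0 < p) {k : ℕ} (hk : k ≠ 0) :
    Integrable fun y => profile p y ^ k := by
  refine (integrable_profile hp).mono' ((continuous_profile hp).pow k).aestronglyMeasurable
    (ae_of_all _ fun y => ?_)
  have h := (profile_pos hp y).le
  rw [Real.norm_of_nonneg (pow_nonneg h k)]
  exact pow_le_of_le_one h (profile_le_one hp y) hk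

lemma tendsto_profile_atBot {p : ℝ} (hp : 0 < p) : Tendsto (profile p) atBot (𝓝 0) := by
  refine squeeze_zero (fun y => (profile_pos hp y).le) (profile_le_exp hp) ?_
  simpa using Real.tendsto_exp_atBot.const_mul (2 / p)

lemma tendsto_profile_atTop {p : ℝ} (hp : 0 < p) : Tendsto (profile p) atTop (𝓝 0) := by
  have := (tendsto_profile_atBot hp).comp tendsto_neg_atTop_atBot
  refine this.congr fun y => profile_neg p y

lemma hasDerivAt_profile {p : ℝ} (hp : 0 < p) (y : ℝ) :
    HasDerivAt (profile p) (-(p * Real.sinh y) * profile p y ^ 2) y := by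
  have h : HasDerivAt (fun y => 1 + p * Real.cosh y) (p * Real.sinh y) y :=
    ((Real.hasDerivAt_cosh y).const_mul p).const_add 1
  refine (h.fun_inv (profile_denom_pos hp y).ne').congr_deriv ?_
  simp only [profile]
  field_simp

/-- Hyperbolic functions are eliminated by `sinh² = cosh² - 1` and `p cosh y · q = 1 - q`, where `q`
is the profile. The resulting polynomial in `q` is what links the moments. -/
lemma hasDerivAt_deriv_profile {p : ℝ} (hp : 0 < p) (y : ℝ) :
    HasDerivAt (fun y => -(p * Real.sinh y) * profile p y ^ 2)
      (profile p y - 3 * profile p y ^ 2 + 2 * (1 - p ^ 2) * profile p y ^ 3) y := by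
  have h := ((Real.hasDerivAt_sinh y).const_mul p).fun_neg.fun_mul
    ((hasDerivAt_profile hp y).fun_pow 2)
  refine h.congr_deriv ?_
  have hd := (profile_denom_pos hp y).ne'
  have hc : Real.sinh y ^ 2 = Real.cosh y ^ 2 - 1 := by
    have := Real.cosh_sq y
    linarith
  have hq : p * Real.cosh y * profile p y = 1 - profile p y := by
    simp only [profile]
    field_simp
    ring
  simp only [Nat.cast_ofNat, Nat.add_one_sub_one, pow_one]
  linear_combination 2 * p ^ 2 * profile p y ^ 3 * hc + (-profile p y + 2 * profile p y *
    (p * Real.cosh y * profile p y + 1 - profile p y)) * hq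

lemma abs_deriv_profile_le {p : ℝ} (hp : 0 < p) (y : ℝ) :
    ‖-(p * Real.sinh y) * profile p y ^ 2‖ ≤ profile p y := by
  have hq := profile_pos hp y
  have hs : |Real.sinh y| ≤ Real.cosh y := by
    rw [abs_le, Real.sinh_eq, Real.cosh_eq]
    constructor <;> linarith [Real.exp_pos y, Real.exp_pos (-y)]
  rw [Real.norm_eq_abs, abs_mul, abs_neg, abs_mul, abs_of_pos hp, abs_of_pos (pow_pos hq 2)]
  calc p * |Real.sinh y| * profile p y ^ 2
      ≤ p * Real.cosh y * profile p y ^ 2 := by gcongr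
    _ = (p * Real.cosh y * profile p y) * profile p y := by ring
    _ ≤ 1 * profile p y := by gcongr; exact mul_cosh_mul_profile_le_one hp y
    _ = profile p y := one_mul _

/-- The virial identity relating the first three moments. -/
lemma profileMoment_relation {p : ℝ} (hp : 0 < p) :
    profileMoment 1 p - 3 * profileMoment 2 p + 2 * (1 - p ^ 2) * profileMoment 3 p = 0 := by
  have i1 := integrable_profile hp
  have i2 := (integrable_profile_pow hp two_ne_zero).const_mul 3
  have i3 := (integrable_profile_pow hp three_ne_zero).const_mul (2 * (1 - p ^ 2))
  have i12 : Integrable fun y => profile p y - 3 * profile p y ^ 2 := i1.sub i2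
  -- The second derivative integrates to zero because the first derivative vanishes at both ends.
  have h := integral_of_hasDerivAt_of_tendsto (hasDerivAt_deriv_profile hp) (i12.add i3)
    (squeeze_zero_norm (abs_deriv_profile_le hp) (tendsto_profile_atBot hp))
    (squeeze_zero_norm (abs_deriv_profile_le hp) (tendsto_profile_atTop hp))
  rw [integral_add i12 i3, integral_sub i1 i2, integral_const_mul,
    integral_const_mul] at h
  simpa [profileMoment] using h

lemma profileMoment_pos {p : ℝ} (hp : 0 < p) {k : ℕ} (hk : k ≠ 0) : 0 < profileMoment k p := by
  refine integral_pos_of_integrable_nonneg_nonzero (x := 0) ((continuous_profile hp).pow k)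
    (integrable_profile_pow hp hk) (fun y => (pow_pos (profile_pos hp y) k).le)
    (pow_pos (profile_pos hp 0) k).ne'

/-- Differentiation under the integral sign on `x > p/2`: there the factor `cosh y` is absorbed by
one power of the profile, and monotonicity in the parameter gives the uniform majorant at `p/2`. -/
lemma differentiableAt_profileMoment {p : ℝ} (hp : 0 < p) {k : ℕ} (hk : k ≠ 0) :
    DifferentiableAt ℝ (profileMoment k) p := by
  have hp2 : 0 < p / 2 := by positivity
  refine (hasDerivAt_integral_of_dominated_loc_of_deriv_le
    (F := fun p y => profile p y ^ k)
    (F' := fun p y => (k : ℝ) * profile p y ^ (k - 1) * (-(Real.cosh y) * profile p y ^ 2))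
    (bound := fun y => k * (2 / p) * profile (p / 2) y ^ k)
    (Ioi_mem_nhds (half_lt_self hp)) ?_ (integrable_profile_pow hp hk) ?_ ?_
    ((integrable_profile_pow hp2 hk).const_mul _) ?_).2.differentiableAt
  · filter_upwards [Ioi_mem_nhds hp] with x hx
    exact ((continuous_profile hx).pow k).aestronglyMeasurable
  · have := continuous_profile hp
    exact Continuous.aestronglyMeasurable (by fun_prop)
  · refine ae_of_all _ fun y x hx => ?_
    have hx : p / 2 < x := hx
    have hx0 := hp2.trans hx
    have hq := profile_pos hx0 y
    have hc := Real.cosh_pos y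
    have h1 : Real.cosh y * profile x y ≤ 2 / p := by
      have h2 := mul_cosh_mul_profile_le_one hx0 y
      have h3 : 0 < Real.cosh y * profile x y := mul_pos hc hq
      rw [le_div_iff₀ hp]
      nlinarith
    have h4 : profile x y ^ k = profile x y ^ (k - 1) * profile x y := by
      rw [← pow_succ, Nat.sub_add_cancel (Nat.one_le_iff_ne_zero.2 hk)]
    rw [norm_mul, norm_mul, norm_mul, norm_neg, Real.norm_of_nonneg (Nat.cast_nonneg k),
      Real.norm_of_nonneg (pow_pos hq _).le, Real.norm_of_nonneg hc.le,
      Real.norm_of_nonneg (pow_pos hq 2).le]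
    calc (k : ℝ) * profile x y ^ (k - 1) * (Real.cosh y * profile x y ^ 2)
        = k * (Real.cosh y * profile x y) * profile x y ^ k := by rw [h4]; ring
      _ ≤ k * (2 / p) * profile (p / 2) y ^ k := by
        gcongr
        exact profile_antitone hp2 hx.le y
  · refine ae_of_all _ fun y x hx => ?_
    have hx0 : 0 < x := hp2.trans hx
    have h : HasDerivAt (fun x => 1 + x * Real.cosh y) (Real.cosh y) x := by
      simpa using ((hasDerivAt_id x).mul_const (Real.cosh y)).const_add 1
    have h' := (h.fun_inv (profile_denom_pos hx0 y).ne').fun_pow k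
    refine h'.congr_deriv ?_
    simp only [profile]
    rw [inv_pow _ 2, ← div_eq_mul_inv]


/-! ### The pulse and its integrals `Λ_m`. -/

lemma sqrt_one_sub_beta_pos {α ω : ℝ} (hβ : beta α ω < 1) : 0 < Real.sqrt (1 - beta α ω) :=
  Real.sqrt_pos.2 (by linarith)

lemma pulseSq_eq_profile (α ω z : ℝ) :
    pulseSq α ω z = 4 * ω * profile (Real.sqrt (1 - beta α ω)) (2 * Real.sqrt ω * z) := by
  rw [pulseSq, profile, div_eq_mul_inv]

lemma pulseSq_neg (α ω z : ℝ) : pulseSq α ω (-z) = pulseSq α ω z := by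
  simp only [pulseSq_eq_profile, mul_neg, profile_neg]

section

variable {α ω : ℝ}

lemma pulseSq_pos (hω : 0 < ω) (hβ : beta α ω < 1) (z : ℝ) : 0 < pulseSq α ω z := by
  rw [pulseSq_eq_profile]
  have := profile_pos (sqrt_one_sub_beta_pos hβ) (2 * Real.sqrt ω * z)
  positivity

lemma pulseR_pos (hω : 0 < ω) (hβ : beta α ω < 1) (z : ℝ) : 0 < pulseR α ω z :=
  Real.sqrt_pos.2 (pulseSq_pos hω hβ z)

lemma pulseR_sq (hω : 0 < ω) (hβ : beta α ω < 1) (z : ℝ) : pulseR α ω z ^ 2 = pulseSq α ω z :=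
  Real.sq_sqrt (pulseSq_pos hω hβ z).le

lemma pulseR_pow (hω : 0 < ω) (hβ : beta α ω < 1) (k : ℕ) (z : ℝ) :
    pulseR α ω z ^ (2 * k) = pulseSq α ω z ^ k := by
  rw [pow_mul, pulseR_sq hω hβ]

lemma differentiable_pulseSq (hβ : beta α ω < 1) : Differentiable ℝ (pulseSq α ω) := by
  have h : Differentiable ℝ (profile (Real.sqrt (1 - beta α ω))) := fun y =>
    (hasDerivAt_profile (sqrt_one_sub_beta_pos hβ) y).differentiableAt
  rw [funext (pulseSq_eq_profile α ω)]
  fun_prop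

lemma hasDerivAt_pulseR (hω : 0 < ω) (hβ : beta α ω < 1) (z : ℝ) :
    HasDerivAt (pulseR α ω) (pulseR α ω z * pulseS α ω z) z := by
  have h : DifferentiableAt ℝ (pulseR α ω) z :=
    (differentiable_pulseSq hβ z).sqrt (pulseSq_pos hω hβ z).ne'
  refine h.hasDerivAt.congr_deriv ?_
  rw [pulseS, mul_div_cancel₀ _ (pulseR_pos hω hβ z).ne']

lemma hasDerivAt_pulseSq (hω : 0 < ω) (hβ : beta α ω < 1) (z : ℝ) :
    HasDerivAt (pulseSq α ω) (2 * pulseS α ω z * pulseSq α ω z) z := by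
  have h := (hasDerivAt_pulseR hω hβ z).fun_pow 2
  rw [funext (pulseR_sq hω hβ)] at h
  refine h.congr_deriv ?_
  rw [← pulseR_sq hω hβ]
  simp only [Nat.cast_ofNat, Nat.add_one_sub_one, pow_one]
  ring

lemma pulseSq_le (hω : 0 < ω) (z : ℝ) : pulseSq α ω z ≤ 4 * ω := by
  rw [pulseSq_eq_profile]
  by_cases hp : 0 < Real.sqrt (1 - beta α ω)
  · have := profile_le_one hp (2 * Real.sqrt ω * z)
    nlinarith
  -- For `β ≥ 1` the real square root is `0` and the profile is constantly `1`, so the bound still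
  -- holds.
  · have : Real.sqrt (1 - beta α ω) = 0 := le_antisymm (not_lt.1 hp) (Real.sqrt_nonneg _)
    simp [this, profile]

lemma integrable_pulseSq_pow (hω : 0 < ω) (hβ : beta α ω < 1) {k : ℕ} (hk : k ≠ 0) :
    Integrable fun z => pulseSq α ω z ^ k := by
  have h := (integrable_profile_pow (sqrt_one_sub_beta_pos hβ) hk).comp_mul_left'
    (R := 2 * Real.sqrt ω) (by positivity)
  simp only [pulseSq_eq_profile, mul_pow _ (profile _ _)]
  exact h.const_mul _

/-- Rescaling `y = 2√ω z` moves the dependence on `ω` into an explicit prefactor and the parameter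
`p = √(1 - β)`. -/
lemma Lam_two_mul (hω : 0 < ω) (hβ : beta α ω < 1) (k : ℕ) :
    Lam (2 * k) α ω =
      (4 * ω) ^ k / (2 * Real.sqrt ω) * profileMoment k (Real.sqrt (1 - beta α ω)) := by
  have hs : 0 < 2 * Real.sqrt ω := by positivity
  simp only [Lam, pulseR_pow hω hβ, pulseSq_eq_profile, mul_pow _ (profile _ _)]
  rw [integral_const_mul,
    Measure.integral_comp_mul_left (fun y => profile (Real.sqrt (1 - beta α ω)) y ^ k),
    abs_of_pos (inv_pos.2 hs), smul_eq_mul, profileMoment]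
  field_simp

lemma Lam_four_pos (hω : 0 < ω) (hβ : beta α ω < 1) : 0 < Lam 4 α ω := by
  rw [show 4 = 2 * 2 from rfl, Lam_two_mul hω hβ 2]
  have := profileMoment_pos (sqrt_one_sub_beta_pos hβ) two_ne_zero
  positivity

/-- This is `profileMoment_relation` with `1 - p² = β`, multiplied by `8ω² / (2√ω)`. -/
lemma Lam_relation (hω : 0 < ω) (hβ : beta α ω < 1) :
    2 * ω * Lam 2 α ω - 3 / 2 * Lam 4 α ω - 4 / 3 * α * Lam 6 α ω = 0 := by
  have h := profileMoment_relation (sqrt_one_sub_beta_pos hβ)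
  rw [Real.sq_sqrt (by linarith)] at h
  have h2 := Lam_two_mul hω hβ 1
  have h4 := Lam_two_mul hω hβ 2
  have h6 := Lam_two_mul hω hβ 3
  norm_num at h2 h4 h6
  rw [h2, h4, h6]
  have hb : beta α ω = -(16 / 3) * α * ω := rfl
  have hs : 0 < Real.sqrt ω := Real.sqrt_pos.2 hω
  generalize profileMoment 1 (Real.sqrt (1 - beta α ω)) = J1 at *
  generalize profileMoment 2 (Real.sqrt (1 - beta α ω)) = J2 at *
  generalize profileMoment 3 (Real.sqrt (1 - beta α ω)) = J3 at *
  rw [hb] at h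
  linear_combination (8 * ω ^ 2 / (2 * Real.sqrt ω)) * h

/-- Solving the virial identity for `Λ₆` removes the division by `β`, so the cases `α = 0` and `α ≠
0` need no further distinction. -/
lemma lamD2_eq (hω : 0 < ω) (hβ : beta α ω < 1) : lamD2 α ω = Lam 6 α ω / Lam 4 α ω := by
  rw [lamD2]
  split_ifs with hα
  · rfl
  · have h := Lam_relation hω hβ
    have h4 := (Lam_four_pos hω hβ).ne'
    rw [lam24, beta]
    field_simp
    linear_combination 48 * h

lemma eventually_admissible (hω : 0 < ω) (hβ : beta α ω < 1) :
    ∀ᶠ ω' in 𝓝 ω, 0 < ω' ∧ beta α ω' < 1 := by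
  have hc : Continuous (beta α) := by unfold beta; fun_prop
  exact (lt_mem_nhds hω).and (hc.continuousAt.eventually_lt_const hβ)

lemma differentiableAt_Lam (hω : 0 < ω) (hβ : beta α ω < 1) {k : ℕ} (hk : k ≠ 0) :
    DifferentiableAt ℝ (fun ω' => Lam (2 * k) α ω') ω := by
  have hs := sqrt_one_sub_beta_pos hβ
  have hb : DifferentiableAt ℝ (fun ω' => Real.sqrt (1 - beta α ω')) ω := by
    refine DifferentiableAt.sqrt ?_ (by linarith)
    unfold beta
    fun_prop
  have hJ : DifferentiableAt ℝ (fun ω' => profileMoment k (Real.sqrt (1 - beta α ω'))) ω :=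
    
    DifferentiableAt.comp (g := profileMoment k) ω (differentiableAt_profileMoment hs hk) hb
  have hr : DifferentiableAt ℝ (fun ω' => (4 * ω') ^ k / (2 * Real.sqrt ω')) ω := by
    refine DifferentiableAt.fun_div (by fun_prop) ?_ (by positivity)
    exact (differentiableAt_id.sqrt hω.ne').const_mul 2
  refine (hr.mul hJ).congr_of_eventuallyEq ?_
  filter_upwards [eventually_admissible hω hβ] with ω' h
  exact Lam_two_mul h.1 h.2 k

lemma differentiableAt_lam24 (hω : 0 < ω) (hβ : beta α ω < 1) :
    DifferentiableAt ℝ (fun ω' => lam24 α ω') ω :=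
  (differentiableAt_Lam hω hβ one_ne_zero).fun_div (differentiableAt_Lam hω hβ two_ne_zero)
    (Lam_four_pos hω hβ).ne'

lemma differentiableAt_lamD2 (hω : 0 < ω) (hβ : beta α ω < 1) :
    DifferentiableAt ℝ (fun ω' => lamD2 α ω') ω := by
  refine ((differentiableAt_Lam hω hβ three_ne_zero).fun_div
    (differentiableAt_Lam hω hβ two_ne_zero)
    (Lam_four_pos hω hβ).ne').congr_of_eventuallyEq ?_
  filter_upwards [eventually_admissible hω hβ] with ω' h
  exact lamD2_eq h.1 h.2

end


/-! ### The variational equation for `δφ` and its bounded solution. -/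

/-- The integrand whose integral drives the `φ`-component, as a function of `R₀²`. -/
def forcing (a b d₁ d₂ α ω Q : ℝ) : ℝ :=
  (b + a * ω) * Q + (d₁ - a) * Q ^ 2 + (d₂ - a * α) * Q ^ 3

lemma bigDelta_pos (a ε : ℝ) : 0 < bigDelta a ε := by unfold bigDelta; positivity

lemma differentiable_steadyField (a b d₁ d₂ α : ℝ) :
    Differentiable ℝ (steadyField a b d₁ d₂ α) := by
  intro p
  have hinv : DifferentiableAt ℝ (fun p : (ℝ × ℝ × ℝ) × (ℝ × ℝ × ℝ) =>
      (1 + p.2.2.2 ^ 2 * a ^ 2)⁻¹) p :=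
    DifferentiableAt.fun_inv (by fun_prop) (bigDelta_pos a p.2.2.2).ne'
  unfold steadyField
  simp only [bigDelta, div_eq_mul_inv]
  fun_prop

/-- Computed as the derivative at `t = 0` along the line through the base point in the given
direction. In the first two components `ε` enters only through `ε²` when `c = 0`, so only the third
has an inhomogeneous term. -/
lemma fderiv_steadyField_apply (a b d₁ d₂ α ω r s x y w : ℝ) :
    fderiv ℝ (steadyField a b d₁ d₂ α) ((r, s, 0), (ω, 0, 0)) ((x, y, w), (0, 0, 1)) =
      (x * s + r * y, -2 * s * y - 2 * r * x - 4 * α * r ^ 3 * x,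
        -2 * s * w - ((b + a * ω) + (d₁ - a) * r ^ 2 + (d₂ - a * α) * r ^ 4)) := by
  have hr : HasDerivAt (fun t : ℝ => r + t * x) x 0 := by
    simpa using ((hasDerivAt_id (0 : ℝ)).mul_const x).const_add r
  have hs : HasDerivAt (fun t : ℝ => s + t * y) y 0 := by
    simpa using ((hasDerivAt_id (0 : ℝ)).mul_const y).const_add s
  have hw : HasDerivAt (fun t : ℝ => t * w) w 0 := by
    simpa using (hasDerivAt_id (0 : ℝ)).mul_const w
  have ht : HasDerivAt (fun t : ℝ => t) 1 0 := hasDerivAt_id 0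
  have ht2 : HasDerivAt (fun t : ℝ => t ^ 2) 0 0 := by simpa using ht.fun_pow 2
  have hD : HasDerivAt (bigDelta a) 0 0 := by
    refine ((ht2.mul_const (a ^ 2)).const_add 1).congr_deriv (zero_mul _)
  have hc : HasDerivAt (fun t : ℝ => (((r + t * x, s + t * y, t * w), (ω, 0, t)) :
      (ℝ × ℝ × ℝ) × (ℝ × ℝ × ℝ))) ((x, y, w), (0, 0, 1)) 0 :=
    (hr.prodMk (hs.prodMk hw)).prodMk
      ((hasDerivAt_const _ _).prodMk ((hasDerivAt_const _ _).prodMk ht))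
  have hF := (differentiable_steadyField a b d₁ d₂ α
    ((r + 0 * x, s + 0 * y, 0 * w), (ω, 0, 0))).hasFDerivAt.comp_hasDerivAt 0 hc
  have h1 := hr.fun_mul hs
  have h2 := (((((hD.fun_neg.fun_mul (hs.fun_pow 2)).fun_add (hD.fun_mul (hw.fun_pow 2))).fun_sub
    ((hasDerivAt_const (0 : ℝ) (0 : ℝ)).fun_mul
      (((ht.mul_const a).fun_mul hs).fun_sub hw))).fun_sub
    (((ht2.mul_const a).mul_const b).const_add (-ω))).fun_sub
    ((((ht2.mul_const a).mul_const d₁).const_add 1).fun_mul (hr.fun_pow 2))).fun_sub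
    ((((ht2.mul_const a).mul_const d₂).const_add α).fun_mul (hr.fun_pow 4))
  have h3 := ((((hD.const_mul (-2)).fun_mul hs).fun_mul hw).fun_sub
    ((hasDerivAt_const (0 : ℝ) (0 : ℝ)).fun_mul
      (hs.fun_add ((ht.mul_const a).fun_mul hw)))).fun_sub
    (ht.fun_mul ((((hr.fun_pow 2).const_mul (d₁ - a)).const_add (b + a * ω)).fun_add
      ((hr.fun_pow 4).const_mul (d₂ - a * α))))
  have h2' := h2.fun_div hD (bigDelta_pos a 0).ne'
  have h3' := h3.fun_div hD (bigDelta_pos a 0).ne'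
  have h := hF.unique (h1.prodMk (h2'.prodMk h3'))
  simp only [zero_mul, add_zero] at h
  rw [h]
  have hD0 : bigDelta a 0 = 1 := by simp [bigDelta]
  refine Prod.ext ?_ (Prod.ext ?_ ?_)
  · simp
  · simp [hD0]
    ring
  · simp [hD0]


/-- The bounded solution of the variational equation for `δφ`, obtained with the integrating
factor `R₀²`. -/
noncomputable def phiSol (a b d₁ d₂ α ω z : ℝ) : ℝ :=
  -(∫ x in Iic z, forcing a b d₁ d₂ α ω (pulseSq α ω x)) / pulseSq α ω z

section

variable {α ω : ℝ}

lemma continuous_pulseSq (hβ : beta α ω < 1) : Continuous (pulseSq α ω) :=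
  (differentiable_pulseSq hβ).continuous

lemma continuous_forcing (a b d₁ d₂ α ω : ℝ) : Continuous (forcing a b d₁ d₂ α ω) := by
  unfold forcing
  fun_prop

lemma integrable_forcing (a b d₁ d₂ : ℝ) (hω : 0 < ω) (hβ : beta α ω < 1) :
    Integrable fun z => forcing a b d₁ d₂ α ω (pulseSq α ω z) := by
  have h1 : Integrable (pulseSq α ω) := by
    simpa using integrable_pulseSq_pow hω hβ one_ne_zero
  exact ((h1.const_mul _).add ((integrable_pulseSq_pow hω hβ two_ne_zero).const_mul _)).add
    ((integrable_pulseSq_pow hω hβ three_ne_zero).const_mul _)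

lemma exists_abs_forcing_le (a b d₁ d₂ α ω L : ℝ) :
    ∃ K, 0 ≤ K ∧ ∀ Q, 0 ≤ Q → Q ≤ L → |forcing a b d₁ d₂ α ω Q| ≤ K * Q := by
  refine ⟨|b + a * ω| + |d₁ - a| * |L| + |d₂ - a * α| * |L| ^ 2, by positivity,
    fun Q hQ hL => ?_⟩
  have hL' : Q ≤ |L| := hL.trans (le_abs_self L)
  have h : forcing a b d₁ d₂ α ω Q
      = ((b + a * ω) + (d₁ - a) * Q + (d₂ - a * α) * Q ^ 2) * Q := by
    unfold forcing
    ring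
  rw [h, abs_mul, abs_of_nonneg hQ]
  refine mul_le_mul_of_nonneg_right ?_ hQ
  refine (abs_add_three _ _ _).trans ?_
  rw [abs_mul, abs_mul, abs_of_nonneg hQ, abs_of_nonneg (pow_nonneg hQ 2)]
  gcongr

/-- On the left half-line the tail integrals of `R₀²` are controlled by `R₀²`. -/
lemma exists_integral_pulseSq_le (hω : 0 < ω) (hβ : beta α ω < 1) :
    ∃ C, 0 ≤ C ∧ ∀ z ≤ 0, ∫ x in Iic z, pulseSq α ω x ≤ C * pulseSq α ω z := by
  have hp := sqrt_one_sub_beta_pos hβ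
  have hs : 0 < 2 * Real.sqrt ω := by positivity
  set p := Real.sqrt (1 - beta α ω)
  set κ := 2 * Real.sqrt ω
  -- `2/p` comes from the upper exponential bound on the profile, `1/κ` from integrating `exp (κ
  -- x)`, and `1 + p` from the lower bound on the left half-line.
  refine ⟨2 / p / κ * (1 + p), by positivity, fun z hz => ?_⟩
  have hint : Integrable (pulseSq α ω) := by
    simpa using integrable_pulseSq_pow hω hβ one_ne_zero
  have h1 : ∫ x in Iic z, pulseSq α ω x ≤ ∫ x in Iic z, 4 * ω * (2 / p) * Real.exp (κ * x) := by
    refine setIntegral_mono hint.integrableOn ((integrableOn_exp_mul_Iic hs z).const_mul _)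
      fun x => ?_
    rw [pulseSq_eq_profile, mul_assoc (4 * ω)]
    exact mul_le_mul_of_nonneg_left (profile_le_exp hp _) (by positivity)
  rw [integral_const_mul, integral_exp_mul_Iic hs] at h1
  have h2 := exp_le_profile hp (y := κ * z) (mul_nonpos_of_nonneg_of_nonpos hs.le hz)
  rw [inv_mul_le_iff₀ (by positivity)] at h2
  refine h1.trans ?_
  rw [pulseSq_eq_profile]
  calc 4 * ω * (2 / p) * (Real.exp (κ * z) / κ)
      = 4 * ω * (2 / p / κ) * Real.exp (κ * z) := by ring
    _ ≤ 4 * ω * (2 / p / κ) * ((1 + p) * profile p (κ * z)) := by gcongr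
    _ = 2 / p / κ * (1 + p) * (4 * ω * profile p (κ * z)) := by ring

lemma tendsto_pulseSq_atBot (hω : 0 < ω) (hβ : beta α ω < 1) :
    Tendsto (pulseSq α ω) atBot (𝓝 0) := by
  have h := ((tendsto_profile_atBot (sqrt_one_sub_beta_pos hβ)).comp
    (tendsto_id.const_mul_atBot (show 0 < 2 * Real.sqrt ω by positivity))).const_mul (4 * ω)
  rw [mul_zero] at h
  exact h.congr fun z => (pulseSq_eq_profile α ω z).symm

lemma hasDerivAt_integral_forcing (a b d₁ d₂ : ℝ) (hω : 0 < ω) (hβ : beta α ω < 1) (z : ℝ) :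
    HasDerivAt (fun z => ∫ x in Iic z, forcing a b d₁ d₂ α ω (pulseSq α ω x))
      (forcing a b d₁ d₂ α ω (pulseSq α ω z)) z := by
  have hint := integrable_forcing a b d₁ d₂ hω hβ
  have hc : Continuous fun x => forcing a b d₁ d₂ α ω (pulseSq α ω x) :=
    (continuous_forcing a b d₁ d₂ α ω).comp (continuous_pulseSq hβ)
  have h := (hc.integral_hasStrictDerivAt 0 z).hasDerivAt.const_add
    (∫ x in Iic (0 : ℝ), forcing a b d₁ d₂ α ω (pulseSq α ω x))
  refine h.congr_of_eventuallyEq (Eventually.of_forall fun y => ?_)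
  simp only
  rw [← intervalIntegral.integral_Iic_sub_Iic hint.integrableOn hint.integrableOn]
  ring

lemma hasDerivAt_phiSol (a b d₁ d₂ : ℝ) (hω : 0 < ω) (hβ : beta α ω < 1) (z : ℝ) :
    HasDerivAt (phiSol a b d₁ d₂ α ω)
      (-2 * pulseS α ω z * phiSol a b d₁ d₂ α ω z - ((b + a * ω) + (d₁ - a) * pulseR α ω z ^ 2
        + (d₂ - a * α) * pulseR α ω z ^ 4)) z := by
  have hQ := (pulseSq_pos hω hβ z).ne'
  have h := (hasDerivAt_integral_forcing a b d₁ d₂ hω hβ z).fun_neg.fun_div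
    (hasDerivAt_pulseSq hω hβ z) hQ
  refine h.congr_deriv ?_
  rw [show 4 = 2 * 2 from rfl, pulseR_pow hω hβ, pulseR_sq hω hβ, phiSol, forcing]
  field_simp
  ring

lemma isPhiEps_phiSol (a b d₁ d₂ : ℝ) (hω : 0 < ω) (hβ : beta α ω < 1) :
    IsPhiEps a b d₁ d₂ α ω (phiSol a b d₁ d₂ α ω) := by
  -- The `(δr, δs)` block is homogeneous and does not see `δφ`, so its zero solution completes the
  -- tangent field.
  refine ⟨fun z => (0, 0, phiSol a b d₁ d₂ α ω z), ⟨fun z => ?_, ?_⟩, fun z => rfl⟩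
  · rw [pulse, fderiv_steadyField_apply]
    simp only [zero_mul, mul_zero, add_zero, sub_zero]
    exact (hasDerivAt_const z 0).prodMk
      ((hasDerivAt_const z 0).prodMk (hasDerivAt_phiSol a b d₁ d₂ hω hβ z))
  · obtain ⟨K, hK, hF⟩ := exists_abs_forcing_le a b d₁ d₂ α ω (4 * ω)
    obtain ⟨C, hC, hI⟩ := exists_integral_pulseSq_le hω hβ
    refine ⟨K * C, ?_⟩
    filter_upwards [eventually_le_atBot 0] with z hz
    have hQ := pulseSq_pos hω hβ z
    have hint : Integrable (pulseSq α ω) := by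
      simpa using integrable_pulseSq_pow hω hβ one_ne_zero
    have h1 : ‖∫ x in Iic z, forcing a b d₁ d₂ α ω (pulseSq α ω x)‖
        ≤ ∫ x in Iic z, K * pulseSq α ω x :=
      norm_integral_le_of_norm_le (hint.const_mul K).integrableOn
        (ae_of_all _ fun x => hF _ (pulseSq_pos hω hβ x).le (pulseSq_le hω x))
    rw [integral_const_mul] at h1
    have h2 : ‖phiSol a b d₁ d₂ α ω z‖ ≤ K * C := by
      rw [phiSol, norm_div, norm_neg, Real.norm_of_nonneg hQ.le, div_le_iff₀ hQ, mul_assoc]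
      exact h1.trans (mul_le_mul_of_nonneg_left (hI z hz) hK)
    simpa [Prod.norm_def] using h2

lemma tendsto_pulseSq_mul_of_bounded (hω : 0 < ω) (hβ : beta α ω < 1) {φ : ℝ → ℝ} {M : ℝ}
    (hM : ∀ᶠ z in atBot, ‖φ z‖ ≤ M) : Tendsto (fun z => pulseSq α ω z * φ z) atBot (𝓝 0) :=
  (tendsto_pulseSq_atBot hω hβ).zero_mul_isBoundedUnder_le
    (isBoundedUnder_of_eventually_le hM)

lemma norm_snd_snd_le (q : ℝ × ℝ × ℝ) : ‖q.2.2‖ ≤ ‖q‖ :=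
  (norm_snd_le q.2).trans (norm_snd_le q)

/-- The product `R₀² φ` has derivative `-F(R₀²)` and, by boundedness of `φ`, limit `0` at `-∞`;
integrating from `-∞` determines it. -/
lemma IsPhiEps.eq_phiSol {a b d₁ d₂ : ℝ} (hω : 0 < ω) (hβ : beta α ω < 1) {φ : ℝ → ℝ}
    (h : IsPhiEps a b d₁ d₂ α ω φ) : φ = phiSol a b d₁ d₂ α ω := by
  obtain ⟨ξ, ⟨hξ, M, hM⟩, hφ⟩ := h
  have hφ' : ∀ z, HasDerivAt φ (-2 * pulseS α ω z * φ z - ((b + a * ω)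
      + (d₁ - a) * pulseR α ω z ^ 2 + (d₂ - a * α) * pulseR α ω z ^ 4)) z := fun z => by
    have h1 := (hξ z).snd.snd
    rw [show ξ z = ((ξ z).1, (ξ z).2.1, (ξ z).2.2) from rfl, pulse, fderiv_steadyField_apply] at h1
    rw [funext hφ]
    exact h1
  have hb : ∀ᶠ z in atBot, ‖φ z‖ ≤ M := by
    filter_upwards [hM] with z hz
    rw [hφ]
    exact (norm_snd_snd_le _).trans hz
  have hd : ∀ z, HasDerivAt (fun z => pulseSq α ω z * φ z)
      (-forcing a b d₁ d₂ α ω (pulseSq α ω z)) z := fun z => by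
    refine ((hasDerivAt_pulseSq hω hβ z).fun_mul (hφ' z)).congr_deriv ?_
    rw [show 4 = 2 * 2 from rfl, pulseR_pow hω hβ, pulseR_sq hω hβ, forcing]
    ring
  funext z
  have h := integral_Iic_of_hasDerivAt_of_tendsto (hd z).continuousAt.continuousWithinAt
    (fun x _ => hd x) (integrable_forcing a b d₁ d₂ hω hβ).neg.integrableOn
    (tendsto_pulseSq_mul_of_bounded hω hβ hb)
  rw [integral_neg, sub_zero] at h
  rw [phiSol, h, mul_div_cancel_left₀ _ (pulseSq_pos hω hβ z).ne']

lemma phiEps_eq_phiSol (a b d₁ d₂ : ℝ) (hω : 0 < ω) (hβ : beta α ω < 1) :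
    phiEps a b d₁ d₂ α ω = phiSol a b d₁ d₂ α ω :=
  (Classical.epsilon_spec ⟨_, isPhiEps_phiSol a b d₁ d₂ hω hβ⟩ :
    IsPhiEps a b d₁ d₂ α ω (phiEps a b d₁ d₂ α ω)).eq_phiSol hω hβ

lemma phiSol_zero (a b d₁ d₂ : ℝ) (hω : 0 < ω) (hβ : beta α ω < 1) :
    phiSol a b d₁ d₂ α ω 0 =
      -(Lam 4 α ω / (2 * pulseSq α ω 0)) * (d₁ - dOneStar a b d₂ α ω) := by
  have hint := integrable_forcing a b d₁ d₂ hω hβ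
  have h1 := intervalIntegral.integral_Iic_add_Ioi (b := 0) hint.integrableOn hint.integrableOn
  -- By evenness of `R₀²` the two half-line integrals agree, so each is half of the total.
  have h2 := integral_comp_neg_Iic 0 fun z => forcing a b d₁ d₂ α ω (pulseSq α ω z)
  simp only [pulseSq_neg, neg_zero] at h2
  have i1 : Integrable (pulseSq α ω) := by
    simpa using integrable_pulseSq_pow hω hβ one_ne_zero
  have i1' := i1.const_mul (b + a * ω)
  have i2 := (integrable_pulseSq_pow hω hβ two_ne_zero).const_mul (d₁ - a)
  have i3 := (integrable_pulseSq_pow hω hβ three_ne_zero).const_mul (d₂ - a * α)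
  have i12 : Integrable fun z => (b + a * ω) * pulseSq α ω z + (d₁ - a) * pulseSq α ω z ^ 2 :=
    i1'.add i2
  have h3 : ∫ z, forcing a b d₁ d₂ α ω (pulseSq α ω z) =
      (b + a * ω) * Lam 2 α ω + (d₁ - a) * Lam 4 α ω + (d₂ - a * α) * Lam 6 α ω := by
    simp only [forcing, Lam]
    rw [integral_add i12 i3, integral_add i1' i2, integral_const_mul, integral_const_mul,
      integral_const_mul]
    simp only [show 4 = 2 * 2 from rfl, show 6 = 2 * 3 from rfl, pulseR_pow hω hβ,
      pulseR_sq hω hβ]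
  have hQ := (pulseSq_pos hω hβ 0).ne'
  have h4 := (Lam_four_pos hω hβ).ne'
  have hrel := Lam_relation hω hβ
  have h5 : ∫ z in Iic 0, forcing a b d₁ d₂ α ω (pulseSq α ω z) =
      ((b + a * ω) * Lam 2 α ω + (d₁ - a) * Lam 4 α ω + (d₂ - a * α) * Lam 6 α ω) / 2 := by
    linarith
  rw [phiSol, h5, dOneStar, lamD2_eq hω hβ, lam24]
  field_simp
  linear_combination -6 * a * hrel

end


/-! ### Families of trajectories on the unstable manifold. -/

section

variable {a b d₁ d₂ α ω ε₀ T : ℝ} {W : ℝ → ℝ → ℝ × ℝ × ℝ}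

lemma IsUnstableFamily.hasDerivAt_sq_mul (h : IsUnstableFamily a b d₁ d₂ α ω ε₀ T W) {ε z : ℝ}
    (hε : |ε| < ε₀) (hz : z < T) :
    HasDerivAt (fun t => (W ε t).1 ^ 2 * (W ε t).2.2)
      (-(ε / bigDelta a ε) * forcing a b d₁ d₂ α ω ((W ε z).1 ^ 2)) z := by
  have h0 := h.solves ε hε z hz
  have h1 : HasDerivAt (fun t => (W ε t).1) _ z := h0.fst
  have h2 : HasDerivAt (fun t => (W ε t).2.2) _ z := h0.snd.snd
  refine ((h1.fun_pow 2).fun_mul h2).congr_deriv ?_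
  have hD := (bigDelta_pos a ε).ne'
  obtain ⟨r, s, φ⟩ := W ε z
  simp only [steadyField, forcing]
  field_simp
  simp only [Nat.cast_ofNat]
  ring

lemma IsUnstableFamily.differentiableAt (h : IsUnstableFamily a b d₁ d₂ α ω ε₀ T W)
    (hε₀ : 0 < ε₀) {z : ℝ} (hz : z < T) : DifferentiableAt ℝ (fun ε => W ε z) 0 := by
  have hU : Ioo (-ε₀) ε₀ ×ˢ Iio T ∈ 𝓝 ((0 : ℝ), z) :=
    prod_mem_nhds (Ioo_mem_nhds (neg_neg_of_pos hε₀) hε₀) (Iio_mem_nhds hz)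
  have h1 : DifferentiableAt ℝ (Function.uncurry W) (0, z) :=
    (h.smooth.contDiffAt hU).differentiableAt one_ne_zero
  have h2 : DifferentiableAt ℝ (fun ε : ℝ => (ε, z)) 0 := by fun_prop
  exact DifferentiableAt.comp (g := Function.uncurry W) 0 h1 h2

lemma IsUnstableFamily.continuousOn_forcing (h : IsUnstableFamily a b d₁ d₂ α ω ε₀ T W) :
    ContinuousOn (fun q : ℝ × ℝ => forcing a b d₁ d₂ α ω ((W q.1 q.2).1 ^ 2))
      (Ioo (-ε₀) ε₀ ×ˢ Iio T) :=
  (continuous_forcing a b d₁ d₂ α ω).comp_continuousOn (h.smooth.continuousOn.fst.pow 2)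

lemma IsUnstableFamily.continuousAt_integral (h : IsUnstableFamily a b d₁ d₂ α ω ε₀ T W)
    (hε₀ : 0 < ε₀) {z₀ z : ℝ} (hz₀ : z₀ ≤ z) (hz : z < T) :
    ContinuousAt (fun ε => ∫ t in z₀..z, forcing a b d₁ d₂ α ω ((W ε t).1 ^ 2)) 0 := by
  have hg := h.continuousOn_forcing
  -- On a compact rectangle inside the domain, continuity supplies the constant majorant for
  -- dominated convergence.
  have hsub : Icc (-(ε₀ / 2)) (ε₀ / 2) ×ˢ Icc z₀ z ⊆ Ioo (-ε₀) ε₀ ×ˢ Iio T :=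
    prod_mono (Icc_subset_Ioo (by linarith) (by linarith)) fun t ht => ht.2.trans_lt hz
  obtain ⟨C, hC⟩ := (isCompact_Icc.prod isCompact_Icc).exists_bound_of_continuousOn (hg.mono hsub)
  have hmem : Icc (-(ε₀ / 2)) (ε₀ / 2) ∈ 𝓝 (0 : ℝ) := Icc_mem_nhds (by linarith) (by linarith)
  refine intervalIntegral.continuousAt_of_dominated_interval (bound := fun _ => C) ?_ ?_
    intervalIntegrable_const (ae_of_all _ fun t ht => ?_)
  · filter_upwards [hmem] with ε hε
    rw [uIoc_of_le hz₀]
    refine ContinuousOn.aestronglyMeasurable ?_ measurableSet_Ioc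
    exact (hg.mono hsub).comp (f := fun t : ℝ => (ε, t)) (by fun_prop)
      fun t ht => ⟨hε, Ioc_subset_Icc_self ht⟩
  · filter_upwards [hmem] with ε hε
    refine ae_of_all _ fun t ht => ?_
    rw [uIoc_of_le hz₀] at ht
    exact hC (ε, t) ⟨hε, Ioc_subset_Icc_self ht⟩
  · rw [uIoc_of_le hz₀] at ht
    have hU : Ioo (-ε₀) ε₀ ×ˢ Iio T ∈ 𝓝 ((0 : ℝ), t) :=
      prod_mem_nhds (Ioo_mem_nhds (neg_neg_of_pos hε₀) hε₀) (Iio_mem_nhds (ht.2.trans_lt hz))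
    exact ContinuousAt.comp (f := fun ε : ℝ => (ε, t)) (hg.continuousAt hU) (by fun_prop)

lemma IsUnstableFamily.sub_eq_integral (h : IsUnstableFamily a b d₁ d₂ α ω ε₀ T W)
    {ε z₀ z : ℝ} (hε : |ε| < ε₀) (hz₀ : z₀ ≤ z) (hz : z < T) :
    (W ε z).1 ^ 2 * (W ε z).2.2 - (W ε z₀).1 ^ 2 * (W ε z₀).2.2 =
      ε * (-(1 / bigDelta a ε) * ∫ t in z₀..z, forcing a b d₁ d₂ α ω ((W ε t).1 ^ 2)) := by
  have hc : ContinuousOn (fun t => forcing a b d₁ d₂ α ω ((W ε t).1 ^ 2)) (uIcc z₀ z) := by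
    rw [uIcc_of_le hz₀]
    exact h.continuousOn_forcing.comp (f := fun t : ℝ => (ε, t)) (by fun_prop)
      fun t ht => ⟨abs_lt.1 hε, ht.2.trans_lt hz⟩
  rw [← intervalIntegral.integral_eq_sub_of_hasDerivAt
    (fun t ht => h.hasDerivAt_sq_mul hε ?_) (hc.intervalIntegrable.const_mul _)]
  · rw [intervalIntegral.integral_const_mul]
    ring
  · rw [uIcc_of_le hz₀] at ht
    exact ht.2.trans_lt hz

/-- The difference quotient is `K` itself. Because `ε` factors out of the integrated law, the
integral need only be continuous in `ε`. -/
lemma hasDerivAt_id_mul_of_continuousAt {K : ℝ → ℝ} (hK : ContinuousAt K 0) :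
    HasDerivAt (fun ε => ε * K ε) (K 0) 0 := by
  rw [hasDerivAt_iff_tendsto_slope]
  refine (hK.tendsto.mono_left nhdsWithin_le_nhds).congr' ?_
  filter_upwards [self_mem_nhdsWithin] with ε hε
  have hε' : ε ≠ 0 := hε
  simp [slope_def_field, hε']

lemma IsUnstableFamily.hasDerivAt_phi (h : IsUnstableFamily a b d₁ d₂ α ω ε₀ T W)
    (hω : 0 < ω) (hβ : beta α ω < 1) (hε₀ : 0 < ε₀) {z : ℝ} (hz : z < T) :
    HasDerivAt (fun ε => (W ε z).2.2) (phiSol a b d₁ d₂ α ω z) 0 := by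
  set ψ : ℝ → ℝ := fun z => (deriv (fun ε => W ε z) 0).2.2
  have hψ : ∀ t < T, HasDerivAt (fun ε => (W ε t).2.2) (ψ t) 0 := fun t ht =>
    (h.differentiableAt hε₀ ht).hasDerivAt.snd.snd
  have hsq : ∀ t < T, HasDerivAt (fun ε => (W ε t).1 ^ 2 * (W ε t).2.2)
      (pulseSq α ω t * ψ t) 0 := fun t ht => by
    -- The contribution of `∂_ε r` drops out, being multiplied by `φ = 0` on the wave.
    have h1 : HasDerivAt (fun ε => (W ε t).1) _ 0 := (h.differentiableAt hε₀ ht).hasDerivAt.fst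
    refine ((h1.fun_pow 2).fun_mul (hψ t ht)).congr_deriv ?_
    rw [h.wave t ht, pulse, pulseR_sq hω hβ, mul_zero, zero_add]
  have hkey : ∀ z₀ ≤ z, pulseSq α ω z * ψ z - pulseSq α ω z₀ * ψ z₀ =
      -∫ t in z₀..z, forcing a b d₁ d₂ α ω (pulseSq α ω t) := fun z₀ hz₀ => by
    have hD : ContinuousAt (fun ε => -(1 / bigDelta a ε)) 0 := by
      have : Continuous (bigDelta a) := by unfold bigDelta; fun_prop
      exact (continuousAt_const.div this.continuousAt (bigDelta_pos a 0).ne').neg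
    have h1 := hasDerivAt_id_mul_of_continuousAt (hD.mul (h.continuousAt_integral hε₀ hz₀ hz))
    have h2 := (hsq z hz).fun_sub (hsq z₀ (hz₀.trans_lt hz))
    have h3 := h2.unique (h1.congr_of_eventuallyEq ?_)
    · rw [h3]
      have h4 : ∫ t in z₀..z, forcing a b d₁ d₂ α ω ((W 0 t).1 ^ 2) =
          ∫ t in z₀..z, forcing a b d₁ d₂ α ω (pulseSq α ω t) := by
        refine intervalIntegral.integral_congr fun t ht => ?_
        rw [uIcc_of_le hz₀] at ht
        simp only [h.wave t (ht.2.trans_lt hz), pulse, pulseR_sq hω hβ]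
      simp [h4, bigDelta]
    · filter_upwards [Ioo_mem_nhds (neg_neg_of_pos hε₀) hε₀] with ε hε
      exact h.sub_eq_integral (abs_lt.2 hε) hz₀ hz
  obtain ⟨M, hM⟩ := h.bounded
  -- Let `z₀ → -∞`: the boundary term vanishes because `ψ` is bounded there and `R₀²` decays.
  have hlim : Tendsto (fun z₀ => pulseSq α ω z * ψ z - pulseSq α ω z₀ * ψ z₀) atBot
      (𝓝 (pulseSq α ω z * ψ z - 0)) :=
    tendsto_const_nhds.sub (tendsto_pulseSq_mul_of_bounded hω hβ (M := M)
      (hM.mono fun t ht => (norm_snd_snd_le _).trans ht))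
  have hlim' := (intervalIntegral_tendsto_integral_Iic z
    (integrable_forcing a b d₁ d₂ hω hβ).integrableOn tendsto_id).neg
  have heq := tendsto_nhds_unique (hlim.congr' ((eventually_le_atBot z).mono hkey)) hlim'
  have hval : ψ z = phiSol a b d₁ d₂ α ω z := by
    rw [phiSol, ← heq, sub_zero, mul_div_cancel_left₀ _ (pulseSq_pos hω hβ z).ne']
  exact hval ▸ hψ z hz

end

/-! ### Differentiation in `ω` and the main theorem. -/

lemma hasDerivAt_phiEps_zero (a b d₂ : ℝ) {α ω : ℝ} (hω : 0 < ω) (hβ : beta α ω < 1) :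
    HasDerivAt (fun ω' => phiEps a b (dOneStar a b d₂ α ω) d₂ α ω' 0)
      (-(Lam 4 α ω / (2 * pulseR α ω 0 ^ 2)) *
        (deriv (fun ω' => lam24 α ω') ω * b +
          deriv (fun ω' => lamD2 α ω') ω * (d₂ - 1 / 3 * α * a))) ω := by
  -- Differentiability of the prefactor suffices; its derivative is multiplied by `d₁ - d₁*(ω) = 0`
  -- in the product rule.
  have hA : DifferentiableAt ℝ (fun ω' => -(Lam 4 α ω' / (2 * pulseSq α ω' 0))) ω := by
    have h4 := differentiableAt_Lam hω hβ (k := 2) two_ne_zero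
    have hQ : DifferentiableAt ℝ (fun ω' => pulseSq α ω' 0) ω := by
      have hs : DifferentiableAt ℝ (fun ω' => Real.sqrt (1 - beta α ω')) ω := by
        refine DifferentiableAt.sqrt ?_ (by linarith)
        unfold beta
        fun_prop
      simp only [pulseSq, mul_zero, Real.cosh_zero, mul_one]
      exact DifferentiableAt.fun_div (by fun_prop) (by fun_prop)
        (by have := Real.sqrt_nonneg (1 - beta α ω); positivity)
    exact (h4.fun_div (hQ.const_mul 2) (by have := pulseSq_pos hω hβ 0; positivity)).fun_neg
  have h1 := ((differentiableAt_lam24 hω hβ).hasDerivAt.mul_const b)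
  have h2 := ((differentiableAt_lamD2 hω hβ).hasDerivAt.mul_const (d₂ - 1 / 3 * α * a))
  have h3 : HasDerivAt (fun ω' => dOneStar a b d₂ α ω') _ ω := (h1.const_sub (1 / 4 * a)).fun_sub h2
  have h4 := (hA.hasDerivAt.fun_mul (h3.const_sub (dOneStar a b d₂ α ω))).congr_of_eventuallyEq
    (f₁ := fun ω' => phiEps a b (dOneStar a b d₂ α ω) d₂ α ω' 0) ?_
  · refine h4.congr_deriv ?_
    rw [pulseR_sq hω hβ]
    ring
  · filter_upwards [eventually_admissible hω hβ] with ω' h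
    rw [phiEps_eq_phiSol a b _ d₂ h.1 h.2, phiSol_zero a b _ d₂ h.1 h.2]

end PulseCQNLS

theorem mainTheorem7 (a b d₂ α ω : ℝ) (hω : 0 < ω) (hβ : PulseCQNLS.beta α ω < 1) :
    (∀ d₁ ω' : ℝ, 0 < ω' → PulseCQNLS.beta α ω' < 1 →
      (∃! φ : ℝ → ℝ, PulseCQNLS.IsPhiEps a b d₁ d₂ α ω' φ) ∧
      PulseCQNLS.IsPhiEps a b d₁ d₂ α ω' (PulseCQNLS.phiEps a b d₁ d₂ α ω') ∧
      ∀ (ε₀ T : ℝ) (W : ℝ → ℝ → ℝ × ℝ × ℝ), 0 < ε₀ →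
        PulseCQNLS.IsUnstableFamily a b d₁ d₂ α ω' ε₀ T W →
        ∀ z < T, HasDerivAt (fun ε => (W ε z).2.2)
          (PulseCQNLS.phiEps a b d₁ d₂ α ω' z) 0) ∧
    DifferentiableAt ℝ (fun ω' => PulseCQNLS.lam24 α ω') ω ∧
    DifferentiableAt ℝ (fun ω' => PulseCQNLS.lamD2 α ω') ω ∧
    HasDerivAt
      (fun ω' => PulseCQNLS.phiEps a b (PulseCQNLS.dOneStar a b d₂ α ω) d₂ α ω' 0)
      (-(PulseCQNLS.Lam 4 α ω / (2 * PulseCQNLS.pulseR α ω 0 ^ 2)) *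
        (deriv (fun ω' => PulseCQNLS.lam24 α ω') ω * b +
          deriv (fun ω' => PulseCQNLS.lamD2 α ω') ω * (d₂ - 1 / 3 * α * a)))
      ω := by
  refine ⟨fun d₁ ω' hω' hβ' => ?_, PulseCQNLS.differentiableAt_lam24 hω hβ,
    PulseCQNLS.differentiableAt_lamD2 hω hβ, PulseCQNLS.hasDerivAt_phiEps_zero a b d₂ hω hβ⟩
  have hsol := PulseCQNLS.isPhiEps_phiSol a b d₁ d₂ hω' hβ'
  rw [PulseCQNLS.phiEps_eq_phiSol a b d₁ d₂ hω' hβ']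
  exact ⟨⟨_, hsol, fun φ hφ => hφ.eq_phiSol hω' hβ'⟩, hsol,
    fun ε₀ T W hε₀ hW z hz => hW.hasDerivAt_phi hω' hβ' hε₀ hz⟩
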